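/- **The construction.** Fix an integer $n_0\ge 100$ and put $n_k=n_0+k$, $\bar n_k=\sum_{1\le i\le k}n_i^3$ (so $\bar n_0=0$). For every integer $n\ge 26$ fix $N(n)\in\mathbb N$ such that $3\mid 2N(n)+1$ and $\frac{1}{2N(n)+1}\in[\frac1{128n},\frac1{32n}]$. *Diamonds.* Let $Q$ be a cube of side $s$, and $K\subset Q$ the concentric cube of side $s/3$. The diamond over $Q$ with parameter $n$ is obtained by replacing $K$ with two copies, one green and one red, glued along $\partial K$. Subdivide $Q$ into $(2N(n)+1)^3$ equal closed subcubes; their lifts are the cells of the diamond. The two lifts of the central subcube are its gates, and the two lifts $c_1,c_2$ of the center of $Q$ form its jump pair. *The spaces.* Let $X_0=[0,1]^3$ with the Euclidean distance and Lebesgue measure $\mu_0$; its only cell is $X_0$, and it has no gates. Given $X_l$, with cells of common side length $s_l$, let $k$ be such that $\bar n_k\le l<\bar n_{k+1}$. If $l=\bar n_k$, all the cells of $X_l$ are called doubled; otherwise the doubled cells are those that are not gates. $X_{l+1}$ is obtained from $X_l$ by replacing each doubled cell with the diamond over it with parameter $n_{k+1}$, and subdividing the other cells into cells of the same size. The gates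 of $X_{l+1}$ are the gates of these diamonds and all the cells of $X_{l+1}$ contained in the non-doubled cells of $X_l$. Let $\pi_{l+1,l}:X_{l+1}\to X_l$ be the projection that identifies the two colors. A cover sheet of $X_{l+1}$ is a subset obtained by choosing one color in each of the diamonds; it is mapped bijectively onto $X_l$ by $\pi_{l+1,l}$. For $p,q\in X_{l+1}$ let $$\varrho(p,q)=\begin{cases} d_{X_l}(\pi_{l+1,l}(p),\pi_{l+1,l}(q)) & \text{if $p,q$ lie in a common cover sheet},\\ \dfrac{s_l}{4n_{k+1}} & \text{if $\{p,q\}$ is the jump pair of one of the diamonds},\\ +\infty&\text{otherwise,}\end{cases}$$ and let $d_{X_{l+1}}(p,q)$ be the infimum of $\sum_{i=0}^{m-1}\varrho(p_i,p_{i+1})$ over all finite chains $p=p_0,\dots,p_m=q$ in $X_{l+1}$. The measure $\mu_{l+1}$ is the one with $(\pi_{l+1,l})_\#\mu_{l+1}=\mu_l$ which is split equally between the two copies of each doubled $K$. *The limit.* $X_\infty$ is the set of sequences $(x_l)_{l\ge0}$ with $x_l\in X_l$ and $\pi_{l+1,l}(x_{l+1})=x_l$, with the metric $d_{X_\infty}(x,y)=\limsup_{l\to\infty}d_{X_l}(x_l,y_l)$,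 and $\mu_\infty$ is the measure on $X_\infty$ whose push-forward under $(x_i)_{i}\mapsto x_l$ is $\mu_l$ for every $l$. **Lemma (The measures are doubling).** There is a universal constant $C$ (independent of $n_0$, of the choice of $N(\cdot)$, of $j$, $p$ and $r$) such that for every $j\in\mathbb N\cup\{\infty\}$ (including $j=0$), every $p\in X_j$ and every $r\in(0,\sqrt3)$, $$\mu_j\bigl(B_{X_j}(p,r)\bigr)\le C\,\mu_j\bigl(B_{X_j}(p,r/2)\bigr),$$ where $B_{X_j}(p,r)=\{q\in X_j: d_{X_j}(p,q)<r\}$. -/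

import Mathlib

open MeasureTheory Filter
open scoped ENNReal NNReal

namespace NQC

/-- The parameters of the construction: the integer `n₀ ≥ 100` and, for each `n`, the integer
`N(n)` such that the subdivision of `[0,1]` into `2N(n)+1` equal intervals has mesh in
`[1/(128n), 1/(32n)]` and `3 ∣ 2N(n)+1`. -/
structure Params where
  n₀ : ℕ
  n₀_ge : 100 ≤ n₀
  N : ℕ → ℕ
  mesh : ∀ n : ℕ, 26 ≤ n →
    (1 : ℝ) / (2 * N n + 1) ∈ Set.Icc (1 / (128 * (n : ℝ))) (1 / (32 * (n : ℝ)))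
  three_dvd : ∀ n : ℕ, 26 ≤ n → 3 ∣ 2 * N n + 1

/-- The space `X₀ = [0,1]³` with the Euclidean metric and Lebesgue measure. -/
abbrev Cube : Type := {x : EuclideanSpace ℝ (Fin 3) // ∀ i, x i ∈ Set.Icc (0 : ℝ) 1}

/-- Lebesgue measure on `[0,1]³`. -/
noncomputable def leb : Measure Cube :=
  (volume : Measure (EuclideanSpace ℝ (Fin 3))).comap Subtype.val

theorem measurableSet_cube :
    MeasurableSet {x : EuclideanSpace ℝ (Fin 3) | ∀ i, x i ∈ Set.Icc (0 : ℝ) 1} := by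
  have : {x : EuclideanSpace ℝ (Fin 3) | ∀ i, x i ∈ Set.Icc (0 : ℝ) 1} =
      ⋂ i, (fun x : EuclideanSpace ℝ (Fin 3) => x i) ⁻¹' Set.Icc (0 : ℝ) 1 := by
    ext x; simp
  rw [this]
  exact MeasurableSet.iInter fun i =>
    (by fun_prop : Measurable fun x : EuclideanSpace ℝ (Fin 3) => x i) measurableSet_Icc

instance : IsProbabilityMeasure leb := by
  constructor
  have h0 : leb Set.univ = volume (Subtype.val '' (Set.univ : Set Cube)) :=
    (MeasurableEmbedding.subtype_coe measurableSet_cube).comap_apply volume Set.univ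
  have h2 := (EuclideanSpace.volume_preserving_symm_measurableEquiv_toLp (Fin 3)).symm
    |>.measure_preimage measurableSet_cube.nullMeasurableSet
  rw [h0, Set.image_univ, Subtype.range_coe_subtype, ← h2]
  trans volume (Set.Icc (0 : Fin 3 → ℝ) 1)
  · congr 1
    ext x
    simp [Set.mem_Icc, Pi.le_def, forall_and]
  · simp [Real.volume_Icc_pi]

/-- Infimum of the costs of the finite chains `p = c 0, c 1, …, c m = q`, for the cost `ϱ`. -/
noncomputable def chainInf {α : Type} (ϱ : α → α → ℝ≥0∞) (p q : α) : ℝ≥0∞ :=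
  ⨅ (m : ℕ) (c : ℕ → α) (_ : c 0 = p) (_ : c m = q), ∑ i ∈ Finset.range m, ϱ (c i) (c (i + 1))

namespace Params

variable (P : Params)

/-- `n̄_k = ∑_{1 ≤ i ≤ k} n_i³`, where `n_i = n₀ + i`. -/
def nbar (k : ℕ) : ℕ := ∑ i ∈ Finset.Icc 1 k, (P.n₀ + i) ^ 3

/-- The `k` with `n̄_k ≤ l < n̄_{k+1}`. -/
def stage (l : ℕ) : ℕ := Nat.findGreatest (fun k => P.nbar k ≤ l) l

theorem stage_spec (l : ℕ) : P.nbar (P.stage l) ≤ l ∧ l < P.nbar (P.stage l + 1) := by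
  constructor
  · exact Nat.findGreatest_spec (P := fun k => P.nbar k ≤ l) (Nat.zero_le l) (by simp [nbar])
  · by_contra! h
    have hle : ∀ k, k ≤ P.nbar k := by
      intro k
      calc k = ∑ i ∈ Finset.Icc 1 k, 1 := by simp
        _ ≤ _ := Finset.sum_le_sum fun i hi =>
          Nat.one_le_pow _ _ (by have := (Finset.mem_Icc.1 hi).1; omega)
    have := Nat.le_findGreatest (P := fun k => P.nbar k ≤ l) ((hle _).trans h) h
    unfold stage at this
    omega

/-- The diamond parameter used in passing from `X_l` to `X_{l+1}`:
`n_{k+1}` for `n̄_k ≤ l < n̄_{k+1}`. -/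
def nAt (l : ℕ) : ℕ := P.n₀ + (P.stage l + 1)

/-- The number of intervals into which each edge of a cell is cut in passing from `X_l` to
`X_{l+1}`. -/
def cuts (l : ℕ) : ℕ := 2 * P.N (P.nAt l) + 1

/-- The number of cells of `X_l` along an edge of `[0,1]³`. -/
def gridSize (l : ℕ) : ℕ := ∏ i ∈ Finset.range l, P.cuts i

/-- The common side length of the cells of `X_l`. -/
noncomputable def side (l : ℕ) : ℝ := 1 / P.gridSize l

/-- The levels `n̄_k`, at which the diamond construction is applied to all the cells. -/
def IsReset (l : ℕ) : Prop := ∃ k, l = P.nbar k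

/-- Gates of `X_l`. A cell of `X_l` lies over a subcube of `[0,1]³` in the grid of side
`side l`, indexed by `a`. All the cells over a given subcube have the same status, so the gates
are recorded through the indices of the subcubes below them.
A cell of `X_{l+1}` is a gate if it is (a lift of) the central subcube of a cell to which the
diamond construction was applied, or if it lies in a gate of `X_l` which was only subdivided. -/
def IsGate : ℕ → (Fin 3 → ℕ) → Prop
  | 0, _ => False
  | l + 1, a =>
    ((P.IsReset l ∨ ¬ IsGate l (fun i => a i / P.cuts l)) ∧
        ∀ i, a i % P.cuts l = P.N (P.nAt l)) ∨
      (¬ P.IsReset l ∧ IsGate l (fun i => a i / P.cuts l))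

/-- (Indices of) the cells of `X_l` to which the diamond construction is applied in passing to
`X_{l+1}`: all the cells if `l = n̄_k`, the cells which are not gates otherwise. -/
def Doubled (l : ℕ) (a : Fin 3 → ℕ) : Prop :=
  (∀ i, a i < P.gridSize l) ∧ (P.IsReset l ∨ ¬ P.IsGate l a)

/-- The closed subcube of `[0,1]³` of side `side l` and index `a`. -/
def subcube (l : ℕ) (a : Fin 3 → ℕ) : Set Cube :=
  {x | ∀ i, x.1 i ∈ Set.Icc ((a i : ℝ) * P.side l) (((a i : ℝ) + 1) * P.side l)}

/-- The interior of the central third `K` of the subcube of index `a`. -/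
def innerK (l : ℕ) (a : Fin 3 → ℕ) : Set Cube :=
  {x | ∀ i, x.1 i ∈ Set.Ioo (((a i : ℝ) + 1 / 3) * P.side l) (((a i : ℝ) + 2 / 3) * P.side l)}

/-- The points of `[0,1]³` over which each point of `X_l` has two lifts to `X_{l+1}`. -/
def branch (l : ℕ) : Set Cube := {x | ∃ a, P.Doubled l a ∧ x ∈ P.innerK l a}

/-- The space `X_l`. A point is a point `x ∈ [0,1]³` with a color label of length `l`
(`false` is green, `true` is red). In passing from `X_i` to `X_{i+1}` the central subcube `K` of
each doubled cell is replaced by a green and a red copy glued along `∂K`, everything else being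
kept: so the `i`-th color matters only if `x` is in the interior of such a `K`, and elsewhere we
normalize it to be green. -/
abbrev X (l : ℕ) : Type :=
  {p : Cube × (Fin l → Bool) // ∀ i, p.2 i = true → p.1 ∈ P.branch i}

/-- The projection `X_{l+1} → X_l`. -/
def proj (l : ℕ) (p : P.X (l + 1)) : P.X l :=
  ⟨(p.1.1, fun i => p.1.2 i.castSucc), fun i h => p.2 i.castSucc h⟩

open Classical in
/-- The lift of `[0,1]³` to `X_l` with color label `b`; its image is the chromatic sheet
of label `b`. -/
noncomputable def sheet (l : ℕ) (b : Fin l → Bool) (x : Cube) : P.X l :=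
  ⟨(x, fun i => b i && decide (x ∈ P.branch i)), fun i h => by simp_all⟩

/-- The closed `3`-cell of `X_l` over the subcube of index `a`, in the chromatic sheet of
label `b`. -/
def cell (l : ℕ) (a : Fin 3 → ℕ) (b : Fin l → Bool) : Set (P.X l) :=
  P.sheet l b '' P.subcube l a

/-- The cover sheet of `X_{l+1}` obtained by choosing the lift of color `σ Q` over each doubled
cell `Q` of `X_l`. -/
def cover (l : ℕ) (σ : Set (P.X l) → Bool) : Set (P.X (l + 1)) :=
  {p | ∀ a b, P.Doubled l a → P.proj l p ∈ P.cell l a b → p.1.1 ∈ P.innerK l a →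
    p.1.2 (Fin.last l) = σ (P.cell l a b)}

/-- `{p, q}` is a jump pair of `X_{l+1}`: the two lifts of the center of a doubled cell of
`X_l`. -/
def IsJump (l : ℕ) (p q : P.X (l + 1)) : Prop :=
  P.proj l p = P.proj l q ∧ p.1.2 (Fin.last l) ≠ q.1.2 (Fin.last l) ∧
    ∃ a, P.Doubled l a ∧ ∀ i, p.1.1.1 i = ((a i : ℝ) + 1 / 2) * P.side l

open Classical in
/-- The cost `ϱ` on `X_{l+1}`, given the metric `d` of `X_l`. -/
noncomputable def cost (l : ℕ) (d : P.X l → P.X l → ℝ≥0∞) (p q : P.X (l + 1)) : ℝ≥0∞ :=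
  if ∃ σ, p ∈ P.cover l σ ∧ q ∈ P.cover l σ then d (P.proj l p) (P.proj l q)
  else if P.IsJump l p q then ENNReal.ofReal (P.side l / (4 * P.nAt l))
  else ⊤

/-- The metric of `X_l`: the Euclidean one for `l = 0`, the infimum of the costs of chains for the
next levels. -/
noncomputable def dist : (l : ℕ) → P.X l → P.X l → ℝ≥0∞
  | 0 => fun p q => edist p.1.1 q.1.1
  | l + 1 => chainInf (P.cost l (dist l))

/-- The open ball of `X_l`. -/
def ball (l : ℕ) (p : P.X l) (r : ℝ) : Set (P.X l) := {q | P.dist l p q < ENNReal.ofReal r}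

open Classical in
/-- The map `X_l → X_{l+1}` that chooses the lift of color `c` over all the doubled cells. -/
noncomputable def lift (l : ℕ) (c : Bool) (p : P.X l) : P.X (l + 1) :=
  ⟨(p.1.1, Fin.snoc (α := fun _ => Bool) p.1.2 (c && decide (p.1.1 ∈ P.branch l))), by
    intro i
    refine Fin.lastCases ?_ (fun j => ?_) i
    · simp
    · simpa using p.2 j⟩

/-- The measure of `X_l`: Lebesgue measure for `l = 0`; the measure of `X_{l+1}` is obtained from
that of `X_l` by giving half of the measure to each of the two copies of what is doubled, and by
keeping the measure elsewhere (where the two lifts agree). -/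
noncomputable def μ : (l : ℕ) → Measure (P.X l)
  | 0 => leb.map (P.sheet 0 Fin.elim0)
  | l + 1 => (2⁻¹ : ℝ≥0∞) • (μ l).map (P.lift l false) + (2⁻¹ : ℝ≥0∞) • (μ l).map (P.lift l true)

/-- The inverse limit `X_∞`. -/
abbrev XInf : Type := {x : (l : ℕ) → P.X l // ∀ l, P.proj l (x (l + 1)) = x l}

/-- The metric of `X_∞`. -/
noncomputable def distInf (p q : P.XInf) : ℝ≥0∞ :=
  limsup (fun l => P.dist l (p.1 l) (q.1 l)) atTop

/-- The open ball of `X_∞`. -/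
def ballInf (p : P.XInf) (r : ℝ) : Set P.XInf := {q | P.distInf p q < ENNReal.ofReal r}

/-- The lift of `[0,1]³` to `X_∞` with color label `b`. -/
noncomputable def sheetInf (b : ℕ → Bool) (x : Cube) : P.XInf :=
  ⟨fun l => P.sheet l (fun i => b i) x, fun _ => rfl⟩

end Params

/-- The uniform probability measure on the two colors. -/
noncomputable def coin : Measure Bool :=
  (2⁻¹ : ℝ≥0∞) • Measure.dirac false + (2⁻¹ : ℝ≥0∞) • Measure.dirac true

instance : IsProbabilityMeasure coin :=
  ⟨by simp [coin, ENNReal.inv_two_add_inv_two]⟩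

namespace Params

variable (P : Params)

/-- The measure of `X_∞`: the average of the Lebesgue measures of the sheets of `X_∞` with respect
to the uniform probability measure on the infinite color labels. By `map_μInf` below it is the
measure on the inverse limit whose image on each `X_l` is `μ l`. -/
noncomputable def μInf : Measure P.XInf :=
  (leb.prod (Measure.infinitePi fun _ : ℕ => coin)).map
    (fun y => P.sheetInf y.2 y.1)

theorem measurableSet_branch (l : ℕ) : MeasurableSet (P.branch l) := by
  have : P.branch l = ⋃ a ∈ {a | P.Doubled l a}, P.innerK l a := by
    ext x; simp [branch]
  rw [this]
  refine MeasurableSet.biUnion (Set.to_countable _) fun a _ => ?_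
  have : P.innerK l a = ⋂ i, (fun x : Cube => x.1 i) ⁻¹'
      Set.Ioo (((a i : ℝ) + 1 / 3) * P.side l) (((a i : ℝ) + 2 / 3) * P.side l) := by
    ext x; simp [innerK]
  rw [this]
  refine MeasurableSet.iInter fun i => ?_
  exact (by fun_prop : Measurable fun x : Cube => x.1 i) measurableSet_Ioo

theorem measurable_sheet (l : ℕ) :
    Measurable fun y : Cube × (ℕ → Bool) => P.sheet l (fun i => y.2 i) y.1 := by
  classical
  refine Measurable.subtype_mk (measurable_fst.prodMk (measurable_pi_lambda _ fun i => ?_))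
  have h1 : Measurable fun y : Cube × (ℕ → Bool) => y.2 i := by fun_prop
  have h2 : Measurable fun y : Cube × (ℕ → Bool) => decide (y.1 ∈ P.branch i) :=
    Measurable.comp (g := fun x : Cube => decide (x ∈ P.branch i))
      (measurable_to_bool (by
        convert P.measurableSet_branch i using 1
        ext x; simp)) measurable_fst
  exact (measurable_of_finite fun z : Bool × Bool => z.1 && z.2).comp (h1.prodMk h2)

theorem measurable_lift (l : ℕ) (c : Bool) : Measurable (P.lift l c) := by
  classical
  refine Measurable.subtype_mk ((by fun_prop : Measurable fun p : P.X l => p.1.1).prodMk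
    (measurable_pi_lambda _ fun i => ?_))
  refine Fin.lastCases ?_ (fun j => ?_) i
  · simp only [Fin.snoc_last]
    have h2 : Measurable fun p : P.X l => decide (p.1.1 ∈ P.branch l) :=
      Measurable.comp (g := fun x : Cube => decide (x ∈ P.branch l))
        (measurable_to_bool (by
          convert P.measurableSet_branch l using 1
          ext x; simp)) (by fun_prop : Measurable fun p : P.X l => p.1.1)
    exact (measurable_of_finite fun z : Bool => c && z).comp h2
  · simp only [Fin.snoc_castSucc]
    fun_prop

theorem measurable_sheetInf :
    Measurable fun y : Cube × (ℕ → Bool) => P.sheetInf y.2 y.1 :=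
  Measurable.subtype_mk (measurable_pi_lambda _ fun l => P.measurable_sheet l)

end Params

theorem infinitePi_coin_split (l : ℕ) :
    Measure.infinitePi (fun _ : ℕ => coin) =
      (2⁻¹ : ℝ≥0∞) • (Measure.infinitePi fun _ : ℕ => coin).map
          (fun b => Function.update b l false) +
        (2⁻¹ : ℝ≥0∞) • (Measure.infinitePi fun _ : ℕ => coin).map
          (fun b => Function.update b l true) := by
  classical
  symm
  refine Measure.eq_infinitePi _ fun s t ht => ?_
  have key : ∀ c : Bool, (Measure.infinitePi fun _ : ℕ => coin).map
      (fun b => Function.update b l c) (Set.pi s t) =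
      ∏ i ∈ s, if i = l then (t l).indicator 1 c else coin (t i) := by
    intro c
    rw [Measure.map_apply (by fun_prop) (MeasurableSet.pi s.countable_toSet fun i _ => ht i)]
    have : (fun b : ℕ → Bool => Function.update b l c) ⁻¹' Set.pi s t =
        Set.pi s (fun i => if i = l then {_b : Bool | c ∈ t l} else t i) := by
      ext b
      simp only [Set.mem_preimage, Set.mem_pi]
      refine forall₂_congr fun i _ => ?_
      by_cases h : i = l
      · subst h; simp
      · simp [h]
    rw [this, Measure.infinitePi_pi _ (fun i _ => by
      split_ifs
      · exact MeasurableSet.const _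
      · exact ht i)]
    refine Finset.prod_congr rfl fun i _ => ?_
    by_cases h : i = l
    · by_cases hc : c ∈ t l <;> simp [h, hc, -Bool.univ_eq]
    · simp [h]
  simp only [Measure.add_apply, Measure.smul_apply, smul_eq_mul, key]
  by_cases hl : l ∈ s
  · rw [← Finset.mul_prod_erase s _ hl, ← Finset.mul_prod_erase s _ hl,
      ← Finset.mul_prod_erase s (fun i => coin (t i)) hl]
    have h : ∀ c : Bool, (∏ i ∈ s.erase l, if i = l then (t l).indicator (1 : Bool → ℝ≥0∞) c
        else coin (t i)) = ∏ i ∈ s.erase l, coin (t i) := fun c =>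
      Finset.prod_congr rfl fun i hi => by simp [Finset.ne_of_mem_erase hi]
    rw [h, h]
    simp only [if_true, ← mul_assoc, ← add_mul]
    congr 1
    simp [coin]
  · have h : ∀ c : Bool, (∏ i ∈ s, if i = l then (t l).indicator (1 : Bool → ℝ≥0∞) c
        else coin (t i)) = ∏ i ∈ s, coin (t i) := fun c =>
      Finset.prod_congr rfl fun i hi => by
        simp [show i ≠ l from fun e => hl (e ▸ hi)]
    rw [h, h, ← add_mul, ENNReal.inv_two_add_inv_two, one_mul]

namespace Params

variable (P : Params)

theorem map_sheet (l : ℕ) :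
    (leb.prod (Measure.infinitePi fun _ : ℕ => coin)).map
      (fun y => P.sheet l (fun i => y.2 i) y.1) = P.μ l := by
  induction l with
  | zero =>
    have h0 : (fun y : Cube × (ℕ → Bool) => P.sheet 0 (fun i => y.2 i) y.1) =
        (fun x => P.sheet 0 Fin.elim0 x) ∘ Prod.fst := by
      ext1 y
      simp only [Function.comp]
      congr 1
      exact Subsingleton.elim _ _
    have hm : Measurable (fun x => P.sheet 0 Fin.elim0 x) :=
      Measurable.subtype_mk (measurable_id.prodMk (measurable_pi_lambda _ fun i => i.elim0))
    rw [h0, ← Measure.map_map hm measurable_fst, Measure.map_fst_prod, measure_univ, one_smul]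
    rfl
  | succ l ih =>
    have hs := P.measurable_sheet l
    have hs' := P.measurable_sheet (l + 1)
    have hup : ∀ c : Bool, Measurable fun b : ℕ → Bool => Function.update b l c :=
      fun c => by fun_prop
    have hlift : ∀ c : Bool, (fun y : Cube × (ℕ → Bool) => P.sheet (l + 1) (fun i => y.2 i) y.1) ∘
        (Prod.map id fun b => Function.update b l c) =
        P.lift l c ∘ fun y => P.sheet l (fun i => y.2 i) y.1 := by
      intro c
      ext1 y
      apply Subtype.ext
      refine Prod.ext rfl (funext fun i => ?_)
      refine Fin.lastCases ?_ (fun j => ?_) i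
      · simp [sheet, lift]
      · have : (j : ℕ) ≠ l := j.2.ne
        simp [sheet, lift, this]
    have hc : ∀ c : Bool, (leb.prod ((Measure.infinitePi fun _ : ℕ => coin).map
        (fun b => Function.update b l c))).map
          (fun y => P.sheet (l + 1) (fun i => y.2 i) y.1) = (P.μ l).map (P.lift l c) := by
      intro c
      rw [← ih, Measure.map_map (P.measurable_lift l c) hs, ← hlift c,
        ← Measure.map_map hs' (measurable_id.prodMap (hup c)),
          ← Measure.map_prod_map _ _ measurable_id (hup c), Measure.map_id]
    rw [infinitePi_coin_split l, Measure.prod_add, Measure.prod_smul_right,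
      Measure.prod_smul_right, Measure.map_add _ _ hs', Measure.map_smul, Measure.map_smul,
      hc, hc]
    rfl

theorem map_μInf (l : ℕ) : P.μInf.map (fun x => x.1 l) = P.μ l := by
  have h : Measurable fun x : P.XInf => x.1 l :=
    (measurable_pi_apply l).comp measurable_subtype_coe
  rw [μInf, Measure.map_map h P.measurable_sheetInf, ← P.map_sheet l]
  rfl

end Params

end NQC

/-!
Every point of `X_j` or `X_∞` is the lift of a point `x` of the cube with a color label `β`, and the
measure is the image of Lebesgue measure times coin tossing. So a ball is measured by describing it
in terms of the pair (point of the cube, label).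

Fix `x` and a radius `r`. Call a level `i` frozen (`Frozen`) if the Euclidean ball `B(x, r)` lies in
the interior of the central third `K` of a doubled cell of level `i`, and does not contain the
center of `K` unless a jump costs at least `r`. A point at distance less than `r` from the lift of
`x` lies over `B(x, r)` and has the same frozen colors (`color_eq_of_dist_lt`): a short path can
neither reach `∂K` nor jump. Conversely, a point over `B(x, ρ)` which has the same colors at the
levels frozen at radius `ρ` is at distance at most `5ρ` (`dist_sheetAt_le_of_frozen`): at the first
level where the colors differ one can go to `∂K`, over which nothing is doubled from this level on,
or jump, which costs more than the correction of all the higher colors.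

Hence, up to constants, the ball of radius `r` has measure `r³` times `2` to the power minus the
number of frozen levels. At most two levels are frozen at radius `r / 16` but not at radius `r`,
because the sizes of the cells decrease fast (`card_le_card_add_two`), and with `ρ = r / 16` the
doubling inequality follows. For `X_∞`, whose metric is the supremum of those of the `X_l`, the
lower bound holds uniformly in `l`, and the upper bound is read off from one `X_l` with `l` large.
-/

namespace NQC

/-! ### Chains -/

section Chains

variable {α : Type} {ϱ : α → α → ℝ≥0∞}

theorem chainInf_le_sum (m : ℕ) (c : ℕ → α) :
    chainInf ϱ (c 0) (c m) ≤ ∑ i ∈ Finset.range m, ϱ (c i) (c (i + 1)) :=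
  iInf_le_of_le m <| iInf_le_of_le c <| iInf_le_of_le rfl <| iInf_le_of_le rfl le_rfl

theorem chainInf_self (p : α) : chainInf ϱ p p = 0 := by
  simpa using chainInf_le_sum (ϱ := ϱ) 0 (fun _ => p)

theorem chainInf_le_cost (p q : α) : chainInf ϱ p q ≤ ϱ p q := by
  simpa using chainInf_le_sum (ϱ := ϱ) 1 (fun i => if i = 0 then p else q)

theorem exists_chain_of_chainInf_lt {p q : α} {r : ℝ≥0∞} (h : chainInf ϱ p q < r) :
    ∃ (m : ℕ) (c : ℕ → α), c 0 = p ∧ c m = q ∧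
      ∑ i ∈ Finset.range m, ϱ (c i) (c (i + 1)) < r := by
  simp only [chainInf, iInf_lt_iff] at h
  obtain ⟨m, c, h0, hm, hc⟩ := h
  exact ⟨m, c, h0, hm, hc⟩

theorem chainInf_triangle (p q s : α) :
    chainInf ϱ p s ≤ chainInf ϱ p q + chainInf ϱ q s := by
  refine ENNReal.le_of_forall_pos_le_add fun ε hε hfin => ?_
  have hε2 : (ε / 2 : ℝ≥0∞) ≠ 0 := by simpa using hε.ne'
  have h1 : chainInf ϱ p q ≠ ⊤ := (lt_of_le_of_lt le_self_add hfin).ne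
  have h2 : chainInf ϱ q s ≠ ⊤ := (lt_of_le_of_lt le_add_self hfin).ne
  obtain ⟨m, c, rfl, rfl, hc⟩ := exists_chain_of_chainInf_lt (ENNReal.lt_add_right h1 hε2)
  obtain ⟨k, e, he0, rfl, he⟩ := exists_chain_of_chainInf_lt (ENNReal.lt_add_right h2 hε2)
  have key := chainInf_le_sum (ϱ := ϱ) (m + k) (fun i => if i ≤ m then c i else e (i - m))
  have hend : (if m + k ≤ m then c (m + k) else e (m + k - m)) = e k := by
    split_ifs with h
    · obtain rfl : k = 0 := by omega
      simpa using he0.symm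
    · simp
  simp only [Nat.zero_le, if_true, hend] at key
  rw [Finset.sum_range_add] at key
  have hA : ∑ i ∈ Finset.range m, ϱ (if i ≤ m then c i else e (i - m))
      (if i + 1 ≤ m then c (i + 1) else e (i + 1 - m)) =
      ∑ i ∈ Finset.range m, ϱ (c i) (c (i + 1)) := by
    refine Finset.sum_congr rfl fun i hi => ?_
    have := Finset.mem_range.1 hi
    rw [if_pos (by omega), if_pos (by omega)]
  have hB : ∑ i ∈ Finset.range k, ϱ (if m + i ≤ m then c (m + i) else e (m + i - m))
      (if m + i + 1 ≤ m then c (m + i + 1) else e (m + i + 1 - m)) =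
      ∑ i ∈ Finset.range k, ϱ (e i) (e (i + 1)) := by
    refine Finset.sum_congr rfl fun i _ => ?_
    have h1 : (if m + i ≤ m then c (m + i) else e (m + i - m)) = e i := by
      split_ifs with h
      · obtain rfl : i = 0 := by omega
        simpa using he0.symm
      · simp
    rw [h1, if_neg (by omega), show m + i + 1 - m = i + 1 by omega]
  rw [hA, hB] at key
  calc chainInf ϱ (c 0) (e k) ≤ _ := key
    _ ≤ (chainInf ϱ (c 0) (c m) + ε / 2) + (chainInf ϱ (c m) (e k) + ε / 2) :=
      add_le_add hc.le he.le
    _ = chainInf ϱ (c 0) (c m) + chainInf ϱ (c m) (e k) + ε := by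
      rw [add_add_add_comm, ENNReal.add_halves]

theorem le_chainInf {D : α → α → ℝ≥0∞} (h0 : ∀ p, D p p = 0)
    (htri : ∀ p q s, D p s ≤ D p q + D q s) (hD : ∀ p q, D p q ≤ ϱ p q) (p q : α) :
    D p q ≤ chainInf ϱ p q := by
  simp only [chainInf, le_iInf_iff]
  rintro m c rfl rfl
  induction m with
  | zero => simp [h0]
  | succ m ih =>
    rw [Finset.sum_range_succ]
    exact (htri _ (c m) _).trans (add_le_add ih (hD _ _))

end Chains

namespace Params

variable (P : Params)

/-! ### The metrics of the spaces `X_l` -/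

theorem dist_self (l : ℕ) (p : P.X l) : P.dist l p p = 0 := by
  cases l with
  | zero => exact edist_self _
  | succ l => exact chainInf_self p

theorem dist_triangle (l : ℕ) (p q s : P.X l) :
    P.dist l p s ≤ P.dist l p q + P.dist l q s := by
  cases l with
  | zero => exact edist_triangle _ _ _
  | succ l => exact chainInf_triangle p q s

theorem dist_proj_le_cost (l : ℕ) (p q : P.X (l + 1)) :
    P.dist l (P.proj l p) (P.proj l q) ≤ P.cost l (P.dist l) p q := by
  unfold cost
  split_ifs with h1 h2
  · exact le_rfl
  · rw [h2.1, dist_self]; exact zero_le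
  · exact le_top

theorem dist_proj_le (l : ℕ) (p q : P.X (l + 1)) :
    P.dist l (P.proj l p) (P.proj l q) ≤ P.dist (l + 1) p q :=
  le_chainInf (D := fun p q => P.dist l (P.proj l p) (P.proj l q)) (fun _ => P.dist_self l _)
    (fun _ _ _ => P.dist_triangle l _ _ _) (P.dist_proj_le_cost l) p q

/-- The lift of `[0,1]³` to `X_l` whose color label is the initial segment of length `l` of the
infinite label `b`. -/
noncomputable abbrev sheetAt (l : ℕ) (b : ℕ → Bool) (x : Cube) : P.X l :=
  P.sheet l (fun i => b i) x

theorem proj_sheetAt (l : ℕ) (b : ℕ → Bool) (x : Cube) :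
    P.proj l (P.sheetAt (l + 1) b x) = P.sheetAt l b x := rfl

theorem sheetAt_congr {l : ℕ} {b b' : ℕ → Bool} {x : Cube}
    (h : ∀ i < l, x ∈ P.branch i → b i = b' i) : P.sheetAt l b x = P.sheetAt l b' x := by
  classical
  refine Subtype.ext (Prod.ext rfl (funext fun i => ?_))
  by_cases hx : x ∈ P.branch i
  · simp [sheet, hx, h i i.2 hx]
  · simp [sheet, hx]

theorem sheetAt_snd_eq {l : ℕ} {b : ℕ → Bool} {x : Cube} (i : Fin l) (h : x ∈ P.branch i) :
    (P.sheetAt l b x).1.2 i = b i := by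
  simp [sheet, h]

/-- Every point of `X_l` lies in one of the sheets. -/
theorem exists_eq_sheetAt (l : ℕ) (p : P.X l) : ∃ b : ℕ → Bool, p = P.sheetAt l b p.1.1 := by
  classical
  refine ⟨fun i => if h : i < l then p.1.2 ⟨i, h⟩ else false, ?_⟩
  refine Subtype.ext (Prod.ext rfl (funext fun i => ?_))
  have := p.2 i
  by_cases hx : p.1.1 ∈ P.branch i
  · simp [sheet, hx]
  · have h : p.1.2 i = false := by simpa using mt this hx
    simp [sheet, hx, h]

/-- Every point of `X_∞` lies in one of the sheets. -/
theorem exists_eq_sheetInf (p : P.XInf) :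
    ∃ (b : ℕ → Bool) (x : Cube), p = P.sheetInf b x := by
  classical
  have hx : ∀ l, (p.1 l).1.1 = (p.1 0).1.1 := by
    intro l
    induction l with
    | zero => rfl
    | succ l ih => rw [← ih, ← p.2 l]; rfl
  have hb : ∀ l (i : Fin l), (p.1 l).1.2 i = (p.1 (i + 1)).1.2 (Fin.last i) := by
    intro l
    induction l with
    | zero => exact fun i => i.elim0
    | succ l ih =>
      intro i
      refine Fin.lastCases rfl (fun j => ?_) i
      have := ih j
      rw [← p.2 l] at this
      exact this
  refine ⟨fun i => (p.1 (i + 1)).1.2 (Fin.last i), (p.1 0).1.1, Subtype.ext (funext fun l => ?_)⟩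
  refine Subtype.ext (Prod.ext (hx l) (funext fun i => ?_))
  have h2 := (p.1 l).2 i
  rw [hx l, hb l i] at h2
  rw [hb l i]
  simp only [sheetInf, sheet]
  by_cases h : (p.1 0).1.1 ∈ P.branch i
  · simp [h]
  · simpa [h] using mt h2 h

theorem sheetAt_mem_cover (l : ℕ) (b : ℕ → Bool) (x : Cube) :
    P.sheetAt (l + 1) b x ∈ P.cover l (fun _ => b l) := by
  intro a _ ha _ hK
  exact P.sheetAt_snd_eq (Fin.last l) (x := x) ⟨a, ha, hK⟩

theorem dist_sheetAt_succ_le {l : ℕ} {b b' : ℕ → Bool} (h : b l = b' l) (x y : Cube) :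
    P.dist (l + 1) (P.sheetAt (l + 1) b x) (P.sheetAt (l + 1) b' y) ≤
      P.dist l (P.sheetAt l b x) (P.sheetAt l b' y) := by
  refine (chainInf_le_cost _ _).trans ?_
  unfold cost
  rw [if_pos ⟨fun _ => b l, P.sheetAt_mem_cover l b x, h ▸ P.sheetAt_mem_cover l b' y⟩]
  exact le_rfl

theorem dist_sheetAt_le_edist (l : ℕ) (b : ℕ → Bool) (x y : Cube) :
    P.dist l (P.sheetAt l b x) (P.sheetAt l b y) ≤ edist x y := by
  induction l with
  | zero => exact le_rfl
  | succ l ih => exact (P.dist_sheetAt_succ_le rfl x y).trans ih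

theorem edist_le_dist (l : ℕ) (p q : P.X l) : edist p.1.1 q.1.1 ≤ P.dist l p q := by
  induction l with
  | zero => exact le_rfl
  | succ l ih => exact (ih (P.proj l p) (P.proj l q)).trans (P.dist_proj_le l p q)

/-! ### The grid -/

theorem nAt_ge (l : ℕ) : 101 ≤ P.nAt l := by
  have := P.n₀_ge
  unfold nAt
  omega

theorem cuts_ge (l : ℕ) : 32 * P.nAt l ≤ P.cuts l := by
  have hn := P.nAt_ge l
  have h := (P.mesh (P.nAt l) (by omega)).2
  have hn' : (0 : ℝ) < 32 * P.nAt l := by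
    have : (0 : ℝ) < P.nAt l := by exact_mod_cast (by omega : 0 < P.nAt l)
    positivity
  rw [one_div_le_one_div (by positivity) hn'] at h
  unfold cuts
  exact_mod_cast h

theorem gridSize_pos (l : ℕ) : 0 < P.gridSize l :=
  Finset.prod_pos fun i _ => by unfold cuts; omega

theorem side_pos (l : ℕ) : 0 < P.side l := by
  have : (0 : ℝ) < P.gridSize l := by exact_mod_cast P.gridSize_pos l
  unfold side
  positivity

theorem side_eq_cuts_mul (l : ℕ) : P.side l = P.cuts l * P.side (l + 1) := by
  have h1 : (P.gridSize l : ℝ) ≠ 0 := by exact_mod_cast (P.gridSize_pos l).ne'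
  have h2 : (P.cuts l : ℝ) ≠ 0 := by exact_mod_cast (by unfold cuts; omega : P.cuts l ≠ 0)
  have h3 : P.gridSize (l + 1) = P.gridSize l * P.cuts l := Finset.prod_range_succ _ _
  unfold side
  rw [h3]
  push_cast
  field_simp

theorem exists_side_eq {l m : ℕ} (h : l ≤ m) : ∃ M : ℕ, P.side l = M * P.side m := by
  induction m, h using Nat.le_induction with
  | base => exact ⟨1, by simp⟩
  | succ m _ ih =>
    obtain ⟨M, hM⟩ := ih
    exact ⟨M * P.cuts m, by rw [hM, P.side_eq_cuts_mul m]; push_cast; ring⟩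

/-- Since `3` divides the number of cuts, the central third of a cell is a union of cells of any
of the next levels. -/
theorem exists_side_eq_three_mul {l m : ℕ} (h : l < m) :
    ∃ M : ℕ, P.side l = 3 * M * P.side m := by
  obtain ⟨M, hM⟩ := P.exists_side_eq (Nat.succ_le_of_lt h)
  obtain ⟨k, hk⟩ := P.three_dvd (P.nAt l) (by have := P.nAt_ge l; omega)
  have hk' : P.cuts l = 3 * k := hk
  refine ⟨k * M, ?_⟩
  rw [P.side_eq_cuts_mul l, hM, hk']
  push_cast
  ring

theorem side_antitone : Antitone P.side := by
  refine antitone_nat_of_succ_le fun l => ?_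
  rw [P.side_eq_cuts_mul l]
  have h1 : (1 : ℝ) ≤ P.cuts l := by exact_mod_cast (by unfold cuts; omega : 1 ≤ P.cuts l)
  nlinarith [P.side_pos (l + 1)]

theorem side_succ_le (l : ℕ) : 3232 * P.side (l + 1) ≤ P.side l := by
  rw [P.side_eq_cuts_mul l]
  have h1 : (3232 : ℝ) ≤ P.cuts l := by
    exact_mod_cast (by have := P.cuts_ge l; have := P.nAt_ge l; omega : 3232 ≤ P.cuts l)
  nlinarith [P.side_pos (l + 1)]

theorem side_le_pow (l : ℕ) : P.side l ≤ (1 / 2) ^ l := by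
  induction l with
  | zero => simp [side, gridSize]
  | succ l ih =>
    have := P.side_succ_le l
    have := P.side_pos (l + 1)
    rw [pow_succ]
    linarith

/-- The cost of a jump is large compared with the cells of the next level. -/
theorem side_succ_le_jump (l : ℕ) : 8 * P.side (l + 1) ≤ P.side l / (4 * P.nAt l) := by
  have hn : (0 : ℝ) < P.nAt l := by exact_mod_cast (by have := P.nAt_ge l; omega : 0 < P.nAt l)
  have hc : (32 * P.nAt l : ℝ) ≤ P.cuts l := by exact_mod_cast P.cuts_ge l
  rw [le_div_iff₀ (by positivity), P.side_eq_cuts_mul l]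
  nlinarith [P.side_pos (l + 1)]

/-- A point with a coordinate in the grid of level `l` is never doubled from level `l` on. -/
theorem notMem_branch_of_coord_eq {l i : ℕ} (hli : l ≤ i) {x : Cube} {k : Fin 3} {m : ℕ}
    (hx : x.1 k = m * P.side l) : x ∉ P.branch i := by
  rintro ⟨a, -, ha⟩
  obtain ⟨M, hM⟩ := P.exists_side_eq hli
  obtain ⟨h1, h2⟩ := ha k
  have hs := P.side_pos i
  rw [hx, hM, ← mul_assoc] at h1 h2
  have h1' := lt_of_mul_lt_mul_right h1 hs.le
  have h2' := lt_of_mul_lt_mul_right h2 hs.le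
  have h3 : (a k : ℝ) < (m * M : ℕ) := by push_cast; linarith
  have h4 : ((m * M : ℕ) : ℝ) < (a k + 1 : ℕ) := by push_cast; linarith
  have h3' := Nat.cast_lt.1 h3
  have h4' := Nat.cast_lt.1 h4
  omega

/-- A point with a coordinate on the boundary of the central third of a cell of level `l` is never
doubled from level `l` on. -/
theorem notMem_branch_of_coord_third {l i : ℕ} (hli : l ≤ i) {x : Cube} {k : Fin 3} {m : ℕ}
    (hx : x.1 k = (m + 1 / 3) * P.side l ∨ x.1 k = (m + 2 / 3) * P.side l) :
    x ∉ P.branch i := by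
  rcases hli.eq_or_lt with rfl | hlt
  · rintro ⟨a, -, ha⟩
    obtain ⟨h1, h2⟩ := ha k
    have hs := P.side_pos l
    rcases hx with hx | hx <;> rw [hx] at h1 h2 <;>
    · have h1' := lt_of_mul_lt_mul_right h1 hs.le
      have h2' := lt_of_mul_lt_mul_right h2 hs.le
      have h3 : (a k : ℝ) < (m + 1 : ℕ) := by push_cast; linarith
      have h4 : (m : ℝ) < (a k + 1 : ℕ) := by push_cast; linarith
      have h3' := Nat.cast_lt.1 h3
      have h4' := Nat.cast_lt.1 h4
      obtain rfl : a k = m := by omega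
      linarith
  · obtain ⟨M, hM⟩ := P.exists_side_eq_three_mul hlt
    rcases hx with hx | hx
    · exact P.notMem_branch_of_coord_eq le_rfl (k := k) (m := (3 * m + 1) * M)
        (by rw [hx, hM]; push_cast; ring)
    · exact P.notMem_branch_of_coord_eq le_rfl (k := k) (m := (3 * m + 2) * M)
        (by rw [hx, hM]; push_cast; ring)

/-- The interior of a cell of level `j > i` which meets the interior of the central third of a cell
of level `i` is contained in it. -/
theorem mem_innerK_of_lt {i j : ℕ} (hij : i < j) {a a' : Fin 3 → ℕ} {x y : Cube}
    (hx : ∀ k, x.1 k ∈ Set.Ioo ((a k : ℝ) * P.side j) ((a k + 1) * P.side j))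
    (hy : ∀ k, y.1 k ∈ Set.Ioo ((a k : ℝ) * P.side j) ((a k + 1) * P.side j))
    (h : x ∈ P.innerK i a') : y ∈ P.innerK i a' := by
  obtain ⟨M, hM⟩ := P.exists_side_eq_three_mul hij
  have hs := P.side_pos j
  intro k
  obtain ⟨h1, h2⟩ := h k
  obtain ⟨h3, h4⟩ := hx k
  obtain ⟨h5, h6⟩ := hy k
  have e1 : ((a' k : ℝ) + 1 / 3) * P.side i = ((3 * a' k + 1) * M : ℕ) * P.side j := by
    rw [hM]; push_cast; ring
  have e2 : ((a' k : ℝ) + 2 / 3) * P.side i = ((3 * a' k + 2) * M : ℕ) * P.side j := by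
    rw [hM]; push_cast; ring
  rw [e1] at h1 ⊢
  rw [e2] at h2 ⊢
  have h7 := lt_of_mul_lt_mul_right (h1.trans h4) hs.le
  have h8 := lt_of_mul_lt_mul_right (h3.trans h2) hs.le
  have h7' : (3 * a' k + 1) * M ≤ a k := Nat.lt_succ_iff.1 (by exact_mod_cast h7)
  have h8' : a k + 1 ≤ (3 * a' k + 2) * M := by exact_mod_cast h8
  have h9 : (((3 * a' k + 1) * M : ℕ) : ℝ) ≤ a k := by exact_mod_cast h7'
  have h10 : ((a k : ℝ) + 1) ≤ ((3 * a' k + 2) * M : ℕ) := by exact_mod_cast h8'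
  exact ⟨(mul_le_mul_of_nonneg_right h9 hs.le).trans_lt h5,
    h6.trans_le (mul_le_mul_of_nonneg_right h10 hs.le)⟩

theorem mem_Ioo_of_mem_innerK {j : ℕ} {a : Fin 3 → ℕ} {x : Cube} (h : x ∈ P.innerK j a)
    (k : Fin 3) : x.1 k ∈ Set.Ioo ((a k : ℝ) * P.side j) ((a k + 1) * P.side j) := by
  have hs := P.side_pos j
  obtain ⟨h1, h2⟩ := h k
  constructor <;> nlinarith

theorem innerK_index_unique {j : ℕ} {a a' : Fin 3 → ℕ} {x : Cube} (h : x ∈ P.innerK j a)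
    (h' : x ∈ P.innerK j a') : a = a' := by
  funext k
  obtain ⟨h1, h2⟩ := P.mem_Ioo_of_mem_innerK h k
  obtain ⟨h3, h4⟩ := P.mem_Ioo_of_mem_innerK h' k
  have hs := P.side_pos j
  have h5 := lt_of_mul_lt_mul_right (h1.trans h4) hs.le
  have h6 := lt_of_mul_lt_mul_right (h3.trans h2) hs.le
  have h5' : a k < a' k + 1 := by exact_mod_cast h5
  have h6' : a' k < a k + 1 := by exact_mod_cast h6
  omega

end Params

/-! ### Moving a point of the cube along one coordinate -/

theorem abs_coord_sub_le_dist (x y : Cube) (k : Fin 3) : |x.1 k - y.1 k| ≤ Dist.dist x y := by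
  have := PiLp.norm_apply_le (x.1 - y.1) k
  rwa [← dist_eq_norm, PiLp.sub_apply, Real.norm_eq_abs] at this

theorem exists_cube_update (x : Cube) (k : Fin 3) {t : ℝ} (ht : t ∈ Set.Icc (0 : ℝ) 1) :
    ∃ z : Cube, z.1 k = t ∧ Dist.dist z x = |t - x.1 k| := by
  classical
  refine ⟨⟨x.1 + EuclideanSpace.single k (t - x.1 k), fun i => ?_⟩, by simp, ?_⟩
  · by_cases h : i = k
    · subst h; simpa using ht
    · simpa [h] using x.2 i
  · rw [Subtype.dist_eq, dist_eq_norm]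
    simp

namespace Params

variable (P : Params)

/-- The color of level `i` is frozen on the ball of center `x` and radius `r` if the ball lies in
the central third of a doubled cell of level `i` and is either disjoint from the jump pair or too
small for a jump. Then a path of length less than `r` starting over `x` cannot change this color.
-/
def Frozen (i : ℕ) (x : Cube) (r : ℝ) : Prop :=
  ∃ a, P.Doubled i a ∧ ∀ y : Cube, Dist.dist y x < r → y ∈ P.innerK i a ∧
    ((∀ k, y.1 k = ((a k : ℝ) + 1 / 2) * P.side i) → r ≤ P.side i / (4 * P.nAt i))

variable {P}

theorem Frozen.mem_branch {i : ℕ} {x y : Cube} {r : ℝ} (h : P.Frozen i x r)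
    (hy : Dist.dist y x < r) : y ∈ P.branch i := by
  obtain ⟨a, ha, H⟩ := h
  exact ⟨a, ha, (H y hy).1⟩

/-- Balls contained in the central third of a cell are small: the cube contains points of the
boundary of the central third, near the given point. -/
theorem Frozen.le_side {i : ℕ} {x : Cube} {r : ℝ} (hr : 0 < r) (h : P.Frozen i x r) :
    r ≤ P.side i := by
  obtain ⟨a, ha, H⟩ := h
  by_contra! hlt
  have hs := P.side_pos i
  obtain ⟨h1, h2⟩ := (H x (by simpa using hr)).1 0
  have hx := x.2 0
  obtain ⟨z, hz, hzx⟩ := exists_cube_update x 0 (t := ((a 0 : ℝ) + 1 / 3) * P.side i)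
    ⟨by positivity, h1.le.trans hx.2⟩
  have h3 := ((H z (by rw [hzx, abs_sub_lt_iff]; constructor <;> nlinarith)).1 0).1
  exact h3.ne' hz

variable (P)

theorem side_le_jump_of_lt {i j : ℕ} (hij : i < j) :
    8 * P.side j ≤ P.side i / (4 * P.nAt i) := by
  have := P.side_antitone (Nat.succ_le_of_lt hij)
  have := P.side_succ_le_jump i
  simp only [Nat.succ_eq_add_one] at *
  linarith

variable {P}

/-- The levels whose color is frozen form an initial segment of the levels at which the point is
doubled. -/
theorem Frozen.of_lt {i j : ℕ} (hij : i < j) {x y : Cube} {r : ℝ} (hr : 0 < r)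
    (h : P.Frozen j x r) (hy : Dist.dist y x < r) (hyi : y ∈ P.branch i) : P.Frozen i x r := by
  have hle := h.le_side hr
  obtain ⟨a, ha, H⟩ := h
  obtain ⟨a', ha', hya⟩ := hyi
  refine ⟨a', ha', fun z hz => ⟨?_, fun _ => ?_⟩⟩
  · exact P.mem_innerK_of_lt hij (P.mem_Ioo_of_mem_innerK (H y hy).1)
      (P.mem_Ioo_of_mem_innerK (H z hz).1) hya
  · have := P.side_le_jump_of_lt hij
    have := P.side_pos j
    linarith

/-! ### Points at small distance have the same frozen colors -/

/-- A point at distance less than `r` has the same frozen colors: along a chain of cost less than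
`r` all the points stay over the Euclidean ball of radius `r`, by induction on the level they lie in
the same cell whenever a color is frozen, and hence no step of the chain can change this color. -/
theorem color_eq_of_dist_lt {x : Cube} {β : ℕ → Bool} {r : ℝ} (hr : 0 < r) (j : ℕ) :
    ∀ q : P.X j, P.dist j (P.sheetAt j β x) q < ENNReal.ofReal r →
      ∀ i : Fin j, P.Frozen i x r → q.1.2 i = β i := by
  induction j with
  | zero => exact fun _ _ i => i.elim0
  | succ j ih =>
    intro q hq i
    refine Fin.lastCases (fun hF => ?_) (fun i hF => ?_) i
    swap
    · exact ih (P.proj j q) ((P.dist_proj_le j _ _).trans_lt hq) i hF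
    simp only [Fin.val_last] at hF ⊢
    obtain ⟨m, c, h0, rfl, hc⟩ := exists_chain_of_chainInf_lt hq
    have hlt : ∀ k ≤ m, P.dist (j + 1) (P.sheetAt (j + 1) β x) (c k) < ENNReal.ofReal r := by
      intro k hk
      rw [← h0]
      refine ((chainInf_le_sum k c).trans ?_).trans_lt hc
      exact Finset.sum_le_sum_of_subset (Finset.range_mono hk)
    have hdist : ∀ k ≤ m, Dist.dist (c k).1.1 x < r := by
      intro k hk
      have := (P.edist_le_dist _ _ _).trans_lt (hlt k hk)
      rw [edist_dist, ENNReal.ofReal_lt_ofReal_iff hr] at this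
      rwa [dist_comm]
    obtain ⟨a, ha, H⟩ := id hF
    have hcell : ∀ k ≤ m, P.proj j (c k) ∈ P.cell j a (fun i => β i) := by
      intro k hk
      have hK := (H _ (hdist k hk)).1
      refine ⟨(c k).1.1, fun i => ⟨(P.mem_Ioo_of_mem_innerK hK i).1.le,
        (P.mem_Ioo_of_mem_innerK hK i).2.le⟩, ?_⟩
      obtain ⟨b, hb⟩ := P.exists_eq_sheetAt j (P.proj j (c k))
      have hcol := ih (P.proj j (c k)) ((P.dist_proj_le j _ _).trans_lt (hlt k hk))
      rw [hb] at hcol ⊢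
      refine P.sheetAt_congr fun i hi hbr => ?_
      rw [← hcol ⟨i, hi⟩ (hF.of_lt hi hr (hdist k hk) hbr)]
      exact P.sheetAt_snd_eq ⟨i, hi⟩ hbr
    have hcol : ∀ k ≤ m, (c k).1.2 (Fin.last j) = β j := by
      intro k
      induction k with
      | zero =>
        intro _
        rw [h0]
        exact P.sheetAt_snd_eq (Fin.last j) (hF.mem_branch (by simpa using hr))
      | succ k ihk =>
        intro hk
        rw [← ihk (by omega)]
        have hcost : P.cost j (P.dist j) (c k) (c (k + 1)) < ENNReal.ofReal r :=
          (Finset.single_le_sum (f := fun i => P.cost j (P.dist j) (c i) (c (i + 1)))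
            (fun _ _ => zero_le) (Finset.mem_range.2 hk)).trans_lt hc
        unfold cost at hcost
        split_ifs at hcost with h1 h2
        · obtain ⟨σ, hσ, hσ'⟩ := h1
          rw [hσ a _ ha (hcell k (by omega)) (H _ (hdist k (by omega))).1,
            hσ' a _ ha (hcell (k + 1) hk) (H _ (hdist (k + 1) hk)).1]
        · exfalso
          obtain ⟨-, -, a', -, hctr⟩ := h2
          have hs := P.side_pos j
          have hK' : (c k).1.1 ∈ P.innerK j a' := fun i => by
            rw [hctr i]
            constructor <;> nlinarith
          obtain ⟨hK, hJ⟩ := H _ (hdist k (by omega))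
          obtain rfl := P.innerK_index_unique hK hK'
          exact absurd hcost (not_lt.2 (ENNReal.ofReal_le_ofReal (hJ hctr)))
        · exact absurd hcost (by simp)
    exact hcol m le_rfl

/-! ### Points with the same frozen colors are at small distance -/

/-- Two lifts of a point with the same colors below level `l` can be joined through the boundary of
a cell of level `l`, where nothing is doubled from level `l` on. -/
theorem dist_sheetAt_le_two_side (j l : ℕ) {b b' : ℕ → Bool} (h : ∀ i < l, b i = b' i)
    (x : Cube) :
    P.dist j (P.sheetAt j b x) (P.sheetAt j b' x) ≤ ENNReal.ofReal (2 * P.side l) := by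
  have hs := P.side_pos l
  have hx := x.2 0
  have hq : 0 ≤ x.1 0 / P.side l := div_nonneg hx.1 hs.le
  have h1 := Nat.floor_le hq
  have h2 := Nat.lt_floor_add_one (x.1 0 / P.side l)
  rw [le_div_iff₀ hs] at h1
  rw [div_lt_iff₀ hs] at h2
  obtain ⟨z, hz, hzx⟩ := exists_cube_update x 0
    (t := (⌊x.1 0 / P.side l⌋₊ : ℝ) * P.side l) ⟨by positivity, h1.trans hx.2⟩
  have hd : edist z x ≤ ENNReal.ofReal (P.side l) := by
    rw [edist_dist]
    refine ENNReal.ofReal_le_ofReal ?_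
    rw [hzx, abs_sub_le_iff]
    constructor <;> nlinarith
  have he : P.sheetAt j b z = P.sheetAt j b' z := P.sheetAt_congr fun i _ hb => by
    by_contra hne
    exact P.notMem_branch_of_coord_eq (not_lt.1 fun hi => hne (h i hi)) hz hb
  have t1 := P.dist_sheetAt_le_edist j b x z
  have t2 := P.dist_sheetAt_le_edist j b' z x
  rw [edist_comm] at t1
  rw [← he] at t2
  calc _ ≤ _ := P.dist_triangle j _ (P.sheetAt j b z) _
    _ ≤ ENNReal.ofReal (P.side l) + ENNReal.ofReal (P.side l) :=
      add_le_add (t1.trans hd) (t2.trans hd)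
    _ = _ := by rw [← ENNReal.ofReal_add hs.le hs.le, two_mul]

/-- Two lifts of the center of a doubled cell of level `L` which differ at most in the color of
level `L` are joined by a jump. -/
theorem dist_sheetAt_le_jump (j : ℕ) {L : ℕ} {a : Fin 3 → ℕ} (ha : P.Doubled L a) {z : Cube}
    (hz : ∀ k, z.1 k = ((a k : ℝ) + 1 / 2) * P.side L) {b b' : ℕ → Bool}
    (h : ∀ i, i ≠ L → b i = b' i) :
    P.dist j (P.sheetAt j b z) (P.sheetAt j b' z) ≤
      ENNReal.ofReal (P.side L / (4 * P.nAt L)) := by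
  induction j with
  | zero => exact (edist_self _).le.trans zero_le
  | succ j ih =>
    by_cases hj : j = L
    · subst hj
      have he : P.sheetAt j b z = P.sheetAt j b' z := P.sheetAt_congr fun i hi _ => h i hi.ne
      by_cases hb : b j = b' j
      · refine (P.dist_sheetAt_succ_le hb z z).trans ?_
        rw [he, dist_self]
        exact zero_le
      · have hs := P.side_pos j
        have hbr : z ∈ P.branch j := ⟨a, ha, fun k => by
          rw [hz k]
          constructor <;> nlinarith⟩
        have hjump : P.IsJump j (P.sheetAt (j + 1) b z) (P.sheetAt (j + 1) b' z) :=
          ⟨he, by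
            rw [P.sheetAt_snd_eq (Fin.last j) hbr, P.sheetAt_snd_eq (Fin.last j) hbr]
            exact hb, a, ha, hz⟩
        refine (chainInf_le_cost _ _).trans ?_
        unfold cost
        rw [if_pos hjump]
        split_ifs
        · rw [proj_sheetAt, proj_sheetAt, he, dist_self]
          exact zero_le
        · exact le_rfl
    · exact (P.dist_sheetAt_succ_le (h j hj) z z).trans ih

/-- A point over the ball of radius `ρ` with the same frozen colors is at distance at most `5 * ρ`.
At the first level at which the colors differ the color is not frozen: it can be changed either on
the boundary of the central third, where all the higher colors can be changed at the same time, or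
by a jump, whose cost dominates that of changing all the higher colors. -/
theorem dist_sheetAt_le_of_frozen (j : ℕ) {x y : Cube} {β b : ℕ → Bool} {ρ : ℝ} (hρ : 0 < ρ)
    (hxy : Dist.dist y x < ρ) (h : ∀ i < j, P.Frozen i x ρ → b i = β i) :
    P.dist j (P.sheetAt j β x) (P.sheetAt j b y) ≤ ENNReal.ofReal (5 * ρ) := by
  classical
  -- Only the colors below `j` at which `x` is doubled matter: the others are replaced by
  -- those of `b`.
  obtain ⟨β', hβ', hne⟩ : ∃ β' : ℕ → Bool, P.sheetAt j β x = P.sheetAt j β' x ∧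
      ∀ i, β' i ≠ b i → x ∈ P.branch i ∧ ¬ P.Frozen i x ρ := by
    refine ⟨fun i => if i < j ∧ x ∈ P.branch i then β i else b i,
      P.sheetAt_congr fun i hi hx => by simp [hi, hx], fun i hi => ?_⟩
    by_cases hc : i < j ∧ x ∈ P.branch i
    · simp only [if_pos hc] at hi
      exact ⟨hc.2, fun hF => hi (h i hc.1 hF).symm⟩
    · simp [if_neg hc] at hi
  rw [hβ']
  by_cases heq : ∀ i, β' i = b i
  · obtain rfl : β' = b := funext heq
    refine (P.dist_sheetAt_le_edist j _ x y).trans ?_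
    rw [edist_comm, edist_dist]
    exact ENNReal.ofReal_le_ofReal (by linarith)
  push Not at heq
  have hmin : ∀ i < Nat.find heq, β' i = b i := fun i hi => by
    simpa using Nat.find_min heq hi
  obtain ⟨hbr, hF⟩ := hne _ (Nat.find_spec heq)
  generalize Nat.find heq = L at hmin hbr hF
  obtain ⟨a, ha, hxa⟩ := hbr
  have hs := P.side_pos L
  -- Colors are changed over `z`, at cost `δ`.
  obtain ⟨z, δ, hzx, hδ, hδ', hz⟩ : ∃ (z : Cube) (δ : ℝ), Dist.dist z x ≤ ρ ∧ 0 ≤ δ ∧ δ ≤ 2 * ρ ∧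
      P.dist j (P.sheetAt j β' z) (P.sheetAt j b z) ≤ ENNReal.ofReal δ := by
    simp only [Frozen, not_exists, not_and, not_forall, exists_prop] at hF
    obtain ⟨w, hw, hw'⟩ := hF a ha
    by_cases hwK : w ∈ P.innerK L a
    · obtain ⟨hctr, hlt⟩ := hw' hwK
      rw [not_le] at hlt
      have h8 := P.side_succ_le_jump L
      have hs' := P.side_pos (L + 1)
      refine ⟨w, P.side L / (4 * P.nAt L) + 2 * P.side (L + 1), hw.le, by positivity,
        by linarith, ?_⟩
      rw [ENNReal.ofReal_add (by positivity) (by positivity)]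
      refine (P.dist_triangle j _ (P.sheetAt j (Function.update β' L (b L)) w) _).trans
        (add_le_add ?_ ?_)
      · exact P.dist_sheetAt_le_jump j ha hctr fun i hi => by simp [hi]
      · refine P.dist_sheetAt_le_two_side j (L + 1) (fun i hi => ?_) w
        by_cases hiL : i = L
        · simp [hiL]
        · simpa [hiL] using hmin i (by omega)
    · simp only [innerK, Set.mem_ofPred_eq, not_forall] at hwK
      obtain ⟨k, hk⟩ := hwK
      have hkd := (abs_coord_sub_le_dist w x k).trans_lt hw
      obtain ⟨h1, h2⟩ := hxa k
      obtain ⟨t, ht, htx⟩ : ∃ t : ℝ, (t = (a k + 1 / 3) * P.side L ∨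
          t = (a k + 2 / 3) * P.side L) ∧ t ∈ Set.Icc (0 : ℝ) 1 ∧ |t - x.1 k| ≤ ρ := by
        have hw0 := w.2 k
        have hx0 := x.2 k
        rw [abs_sub_lt_iff] at hkd
        by_cases hk1 : (a k + 1 / 3) * P.side L < w.1 k
        · have hk2 : (a k + 2 / 3) * P.side L ≤ w.1 k := by
            by_contra! hcon
            exact hk ⟨hk1, hcon⟩
          refine ⟨_, Or.inr rfl, ⟨by positivity, hk2.trans hw0.2⟩, ?_⟩
          rw [abs_sub_le_iff]
          constructor <;> linarith
        · refine ⟨_, Or.inl rfl, ⟨by positivity, h1.le.trans hx0.2⟩, ?_⟩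
          rw [abs_sub_le_iff]
          constructor <;> linarith
      obtain ⟨z, hz, hzx⟩ := exists_cube_update x k htx.1
      refine ⟨z, 0, hzx.trans_le htx.2, le_rfl, by positivity, ?_⟩
      have he : P.sheetAt j β' z = P.sheetAt j b z := P.sheetAt_congr fun i _ hb => by
        by_contra hne
        exact P.notMem_branch_of_coord_third (not_lt.1 fun hi => hne (hmin i hi))
          (by rwa [hz]) hb
      rw [he, dist_self]
      exact zero_le
  have t1 : P.dist j (P.sheetAt j β' x) (P.sheetAt j β' z) ≤ ENNReal.ofReal ρ := by
    refine (P.dist_sheetAt_le_edist j _ x z).trans ?_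
    rw [edist_comm, edist_dist]
    exact ENNReal.ofReal_le_ofReal hzx
  have t2 : P.dist j (P.sheetAt j b z) (P.sheetAt j b y) ≤ ENNReal.ofReal (2 * ρ) := by
    refine (P.dist_sheetAt_le_edist j _ z y).trans ?_
    rw [edist_dist]
    refine ENNReal.ofReal_le_ofReal ?_
    have := _root_.dist_triangle z x y
    rw [dist_comm x y] at this
    linarith
  calc _ ≤ _ := P.dist_triangle j _ (P.sheetAt j β' z) _
    _ ≤ _ := add_le_add le_rfl (P.dist_triangle j _ (P.sheetAt j b z) _)
    _ ≤ ENNReal.ofReal ρ + (ENNReal.ofReal δ + ENNReal.ofReal (2 * ρ)) :=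
      add_le_add t1 (add_le_add hz t2)
    _ = ENNReal.ofReal (ρ + (δ + 2 * ρ)) := by
      rw [← ENNReal.ofReal_add hδ (by positivity), ← ENNReal.ofReal_add hρ.le (by positivity)]
    _ ≤ _ := ENNReal.ofReal_le_ofReal (by linarith)

/-! ### Counting frozen levels -/

/-- Among three levels frozen at radius `r / 16`, the first is frozen at radius `r`: the ball of
radius `r / 16` lies in a cell of the third level, so that the cells of the second level are much
larger than `r`. -/
theorem Frozen.of_lt_of_lt {i₀ i₁ i₂ : ℕ} (h01 : i₀ < i₁) (h12 : i₁ < i₂) {x : Cube} {r : ℝ}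
    (hr : 0 < r) (h0 : P.Frozen i₀ x (r / 16)) (h1 : P.Frozen i₁ x (r / 16))
    (h2 : P.Frozen i₂ x (r / 16)) : P.Frozen i₀ x r := by
  have hr' : (0 : ℝ) < r / 16 := by positivity
  have hle := h2.le_side hr'
  have hs := P.side_antitone (Nat.succ_le_of_lt h12)
  have hs' := P.side_succ_le i₁
  have hs1 := P.side_pos i₁
  simp only [Nat.succ_eq_add_one] at hs
  obtain ⟨a, ha, H⟩ := h0
  obtain ⟨a₁, -, H₁⟩ := h1
  have hx0 := (H x (by simpa using hr')).1
  have hx1 := (H₁ x (by simpa using hr')).1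
  refine ⟨a, ha, fun y hy => ⟨?_, fun _ => ?_⟩⟩
  · refine P.mem_innerK_of_lt h01 (P.mem_Ioo_of_mem_innerK hx1) (fun k => ?_) hx0
    have hk := (abs_coord_sub_le_dist y x k).trans_lt hy
    rw [abs_sub_lt_iff] at hk
    obtain ⟨h3, h4⟩ := hx1 k
    constructor <;> nlinarith
  · have := P.side_le_jump_of_lt h01
    linarith

theorem finite_setOf_frozen (x : Cube) {r : ℝ} (hr : 0 < r) : {i | P.Frozen i x r}.Finite := by
  obtain ⟨n, hn⟩ := exists_pow_lt_of_lt_one hr (by norm_num : (1 / 2 : ℝ) < 1)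
  refine (Set.finite_lt_nat n).subset fun i hi => ?_
  by_contra hlt
  have h1 := (Frozen.le_side hr hi).trans (P.side_antitone (not_lt.1 hlt))
  exact absurd (h1.trans (P.side_le_pow n)) (not_le.2 hn)

theorem card_le_card_add_two {x : Cube} {r : ℝ} (hr : 0 < r) {A B : Finset ℕ}
    (hA : ∀ i ∈ A, P.Frozen i x (r / 16)) (hB : ∀ i ∈ A, P.Frozen i x r → i ∈ B) :
    A.card ≤ B.card + 2 := by
  have h2 : (A \ B).card ≤ 2 := by
    by_contra! h
    obtain ⟨f⟩ : Nonempty (Fin 3 ↪o (A \ B : Finset ℕ)) :=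
      ⟨(Fin.castLEOrderEmb (by omega)).trans ((A \ B).orderIsoOfFin rfl).toOrderEmbedding⟩
    have hm : ∀ k, (f k : ℕ) ∈ A ∧ (f k : ℕ) ∉ B := fun k => Finset.mem_sdiff.1 (f k).2
    have h01 : (f 0 : ℕ) < f 1 := f.strictMono (by decide)
    have h12 : (f 1 : ℕ) < f 2 := f.strictMono (by decide)
    exact (hm 0).2 (hB _ (hm 0).1 (Frozen.of_lt_of_lt h01 h12 hr (hA _ (hm 0).1) (hA _ (hm 1).1)
      (hA _ (hm 2).1)))
  have := Finset.card_le_card_sdiff_add_card (s := A) (t := B)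
  omega

end Params

/-! ### Lebesgue measure of balls of the cube -/

theorem volume_box (lo hi : Fin 3 → ℝ) :
    volume {x : EuclideanSpace ℝ (Fin 3) | ∀ k, x k ∈ Set.Icc (lo k) (hi k)} =
      ∏ k, ENNReal.ofReal (hi k - lo k) := by
  have hm : MeasurableSet {x : EuclideanSpace ℝ (Fin 3) | ∀ k, x k ∈ Set.Icc (lo k) (hi k)} := by
    rw [Set.ofPred_forall]
    exact MeasurableSet.iInter fun k =>
      (by fun_prop : Measurable fun x : EuclideanSpace ℝ (Fin 3) => x k) measurableSet_Icc
  have h2 := (EuclideanSpace.volume_preserving_symm_measurableEquiv_toLp (Fin 3)).symm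
    |>.measure_preimage hm.nullMeasurableSet
  rw [← h2, ← Real.volume_Icc_pi]
  congr 1
  ext x
  simp [Set.mem_Icc, Pi.le_def, forall_and]

theorem leb_apply (s : Set Cube) : leb s = volume (Subtype.val '' s) :=
  (MeasurableEmbedding.subtype_coe measurableSet_cube).comap_apply volume s

theorem leb_ball_le (x : Cube) {r : ℝ} (hr : 0 ≤ r) :
    leb (Metric.ball x r) ≤ ENNReal.ofReal ((2 * r) ^ 3) := by
  have hsub : Subtype.val '' Metric.ball x r ⊆ {y : EuclideanSpace ℝ (Fin 3) |
      ∀ k, y k ∈ Set.Icc (x.1 k - r) (x.1 k + r)} := by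
    rintro _ ⟨y, hy, rfl⟩ k
    have := (abs_coord_sub_le_dist y x k).trans_lt hy
    rw [abs_sub_lt_iff] at this
    constructor <;> linarith
  rw [leb_apply]
  refine (measure_mono hsub).trans ?_
  rw [volume_box, ENNReal.ofReal_pow (by positivity)]
  simp [two_mul, ← sub_add]

theorem le_leb_ball (x : Cube) {r : ℝ} (hr : 0 < r) (hr1 : r ≤ 1) :
    ENNReal.ofReal ((r / 2) ^ 3) ≤ leb (Metric.ball x r) := by
  -- In each coordinate one of the two half-intervals of length `r / 2` stays in `[0, 1]`.
  have hbox : ∀ k, ∃ lo : ℝ, 0 ≤ lo ∧ lo + r / 2 ≤ 1 ∧ x.1 k - r / 2 ≤ lo ∧ lo ≤ x.1 k := by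
    intro k
    obtain ⟨h0, h1⟩ := x.2 k
    by_cases h : x.1 k ≤ 1 / 2
    · exact ⟨x.1 k, h0, by linarith, by linarith, le_rfl⟩
    · exact ⟨x.1 k - r / 2, by linarith, by linarith, le_rfl, by linarith⟩
  choose lo hlo using hbox
  have hsub : {y : EuclideanSpace ℝ (Fin 3) | ∀ k, y k ∈ Set.Icc (lo k) (lo k + r / 2)} ⊆
      Subtype.val '' Metric.ball x r := by
    intro y hy
    have hy1 : ∀ k, y k ∈ Set.Icc (0 : ℝ) 1 := fun k =>
      ⟨(hlo k).1.trans (hy k).1, (hy k).2.trans (hlo k).2.1⟩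
    refine ⟨⟨y, hy1⟩, ?_, rfl⟩
    have hk : ∀ k, (y k - x.1 k) ^ 2 ≤ (r / 2) ^ 2 := fun k => by
      obtain ⟨-, -, h3, h4⟩ := hlo k
      obtain ⟨h5, h6⟩ := hy k
      rw [sq_le_sq, abs_of_pos (by positivity : 0 < r / 2), abs_le]
      constructor <;> linarith
    rw [Metric.mem_ball, Subtype.dist_eq, EuclideanSpace.dist_eq, Real.sqrt_lt' hr,
      Fin.sum_univ_three]
    simp only [Real.dist_eq, sq_abs]
    nlinarith [hk 0, hk 1, hk 2]
  rw [leb_apply]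
  refine le_trans ?_ (measure_mono hsub)
  rw [volume_box, ENNReal.ofReal_pow (by positivity)]
  simp

theorem coin_singleton (c : Bool) : coin {c} = 2⁻¹ := by
  cases c <;> simp [coin]

/-- The measure of a Euclidean ball with finitely many prescribed colors. -/
theorem measure_ball_colors (x : Cube) (r : ℝ) (A : Finset ℕ) (β : ℕ → Bool) :
    (leb.prod (Measure.infinitePi fun _ : ℕ => coin))
      (Metric.ball x r ×ˢ Set.pi A fun i => {β i}) = leb (Metric.ball x r) * 2⁻¹ ^ A.card := by
  rw [Measure.prod_prod, Measure.infinitePi_pi _ fun i _ => measurableSet_singleton _]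
  simp [coin_singleton]

/-- The numerical comparison of the bounds for the measures of a ball and of the ball with half the
radius. -/
theorem leb_ball_mul_le (x : Cube) {r : ℝ} (hr : 0 < r) (hr' : r < √3) {m n : ℕ}
    (h : m ≤ n + 2) :
    leb (Metric.ball x r) * 2⁻¹ ^ n ≤
      (4 * 64 ^ 3 : ℝ≥0) * (leb (Metric.ball x (r / 16)) * 2⁻¹ ^ m) := by
  have hr2 : r < 2 := hr'.trans (by rw [Real.sqrt_lt' (by norm_num)]; norm_num)
  have h1 : leb (Metric.ball x r) ≤ 64 ^ 3 * leb (Metric.ball x (r / 16)) := by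
    refine (leb_ball_le x hr.le).trans ?_
    refine le_trans (le_of_eq ?_)
      (mul_le_mul_right (le_leb_ball x (r := r / 16) (by positivity) (by linarith)) _)
    have h64 : (64 ^ 3 : ℝ≥0∞) = ENNReal.ofReal (64 ^ 3) := by
      rw [ENNReal.ofReal_pow (by norm_num)]
      norm_num
    rw [h64, ← ENNReal.ofReal_mul (by positivity)]
    congr 1
    ring
  have h2 : (2⁻¹ : ℝ≥0∞) ^ n ≤ 4 * 2⁻¹ ^ m := by
    calc (2⁻¹ : ℝ≥0∞) ^ n = 4 * 2⁻¹ ^ (n + 2) := by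
          have h4 : (4 : ℝ≥0∞) * 2⁻¹ ^ 2 = 1 := by
            rw [show (4 : ℝ≥0∞) = 2 ^ 2 by norm_num, ← mul_pow,
              ENNReal.mul_inv_cancel (by norm_num) (by norm_num), one_pow]
          rw [pow_add, mul_left_comm, h4, mul_one]
      _ ≤ 4 * 2⁻¹ ^ m := mul_le_mul_right
          (pow_le_pow_right_of_le_one' (ENNReal.inv_le_one.2 (by norm_num)) h) _
  calc _ ≤ (64 ^ 3 * leb (Metric.ball x (r / 16))) * (4 * 2⁻¹ ^ m) := mul_le_mul' h1 h2
    _ = _ := by push_cast; ring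

namespace Params

variable (P : Params)

/-! ### Measures of balls -/

/-- The points of `X_l` over the ball of center `x` and radius `r` which have the colors of `β` at
the levels in `B`. -/
def colorBall (l : ℕ) (x : Cube) (r : ℝ) (B : Finset ℕ) (β : ℕ → Bool) : Set (P.X l) :=
  {q | q.1.1 ∈ Metric.ball x r ∧ ∀ i : Fin l, (i : ℕ) ∈ B → q.1.2 i = β i}

theorem measurableSet_colorBall (l : ℕ) (x : Cube) (r : ℝ) (B : Finset ℕ) (β : ℕ → Bool) :
    MeasurableSet (P.colorBall l x r B β) := by
  have h : P.colorBall l x r B β = (fun q : P.X l => q.1.1) ⁻¹' Metric.ball x r ∩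
      ⋂ i : Fin l, ⋂ _ : (i : ℕ) ∈ B, (fun q : P.X l => q.1.2 i) ⁻¹' {β i} := by
    ext q
    simp [colorBall]
  rw [h]
  refine ((by fun_prop : Measurable fun q : P.X l => q.1.1) measurableSet_ball).inter ?_
  exact MeasurableSet.iInter fun i => MeasurableSet.iInter fun _ =>
    (by fun_prop : Measurable fun q : P.X l => q.1.2 i) (measurableSet_singleton _)

variable {P}

theorem ball_subset_colorBall (l : ℕ) {x : Cube} {r : ℝ} (hr : 0 < r) {B : Finset ℕ}
    (hB : ∀ i ∈ B, P.Frozen i x r) (β : ℕ → Bool) :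
    P.ball l (P.sheetAt l β x) r ⊆ P.colorBall l x r B β := by
  intro q hq
  refine ⟨?_, fun i hi => color_eq_of_dist_lt hr l q hq i (hB i hi)⟩
  have := (P.edist_le_dist _ _ _).trans_lt hq
  rw [edist_dist, ENNReal.ofReal_lt_ofReal_iff hr, dist_comm] at this
  exact this

theorem measure_colorBall_le (l : ℕ) {x : Cube} {r : ℝ} {B : Finset ℕ}
    (hB : ∀ i ∈ B, i < l ∧ P.Frozen i x r) (β : ℕ → Bool) :
    P.μ l (P.colorBall l x r B β) ≤ leb (Metric.ball x r) * 2⁻¹ ^ B.card := by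
  rw [← P.map_sheet l, Measure.map_apply (P.measurable_sheet l) (P.measurableSet_colorBall ..),
    ← measure_ball_colors x r B β]
  refine measure_mono fun y hy => ⟨hy.1, fun i hi => ?_⟩
  obtain ⟨hil, hF⟩ := hB i hi
  exact (P.sheetAt_snd_eq ⟨i, hil⟩ (hF.mem_branch hy.1)).symm.trans (hy.2 ⟨i, hil⟩ hi)

theorem le_measure_ball (l : ℕ) {x : Cube} {r : ℝ} (hr : 0 < r) {A : Finset ℕ}
    (hA : ∀ i < l, P.Frozen i x (r / 16) → i ∈ A) (β : ℕ → Bool) :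
    leb (Metric.ball x (r / 16)) * 2⁻¹ ^ A.card ≤ P.μ l (P.ball l (P.sheetAt l β x) (r / 2)) := by
  rw [← P.map_sheet l, ← measure_ball_colors x (r / 16) A β]
  refine le_trans (measure_mono ?_) (Measure.le_map_apply (P.measurable_sheet l).aemeasurable _)
  rintro ⟨y, b⟩ ⟨hy, hb⟩
  refine (dist_sheetAt_le_of_frozen l (by positivity : 0 < r / 16) hy fun i hi hF =>
    hb i (hA i hi hF)).trans_lt ?_
  rw [ENNReal.ofReal_lt_ofReal_iff (by positivity)]
  linarith

theorem le_measure_ballInf {x : Cube} {r : ℝ} (hr : 0 < r) {A : Finset ℕ}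
    (hA : ∀ i, P.Frozen i x (r / 16) → i ∈ A) (β : ℕ → Bool) :
    leb (Metric.ball x (r / 16)) * 2⁻¹ ^ A.card ≤
      P.μInf (P.ballInf (P.sheetInf β x) (r / 2)) := by
  rw [μInf, ← measure_ball_colors x (r / 16) A β]
  refine le_trans (measure_mono ?_) (Measure.le_map_apply P.measurable_sheetInf.aemeasurable _)
  rintro ⟨y, b⟩ ⟨hy, hb⟩
  have hle : P.distInf (P.sheetInf β x) (P.sheetInf b y) ≤ ENNReal.ofReal (5 * (r / 16)) :=
    limsup_le_of_le (by isBoundedDefault) (Eventually.of_forall fun l =>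
      dist_sheetAt_le_of_frozen l (by positivity : 0 < r / 16) hy fun i _ hF => hb i (hA i hF))
  refine hle.trans_lt ?_
  rw [ENNReal.ofReal_lt_ofReal_iff (by positivity)]
  linarith

variable (P)

theorem dist_le_distInf (l : ℕ) (p q : P.XInf) : P.dist l (p.1 l) (q.1 l) ≤ P.distInf p q := by
  have hmono : Monotone fun l => P.dist l (p.1 l) (q.1 l) := monotone_nat_of_le_succ fun l => by
    rw [← p.2 l, ← q.2 l]
    exact P.dist_proj_le l _ _
  refine le_limsup_of_frequently_le (Eventually.frequently ?_) (by isBoundedDefault)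
  filter_upwards [eventually_ge_atTop l] with m hm using hmono hm

theorem measure_ball_le_mul (j : ℕ) (p : P.X j) {r : ℝ} (hr : 0 < r) (hr' : r < √3) :
    P.μ j (P.ball j p r) ≤ (4 * 64 ^ 3 : ℝ≥0) * P.μ j (P.ball j p (r / 2)) := by
  classical
  obtain ⟨β, hβ⟩ := P.exists_eq_sheetAt j p
  generalize p.1.1 = x at hβ
  subst hβ
  let A := (Finset.range j).filter fun i => P.Frozen i x (r / 16)
  let B := (Finset.range j).filter fun i => P.Frozen i x r
  have hB : ∀ i ∈ B, i < j ∧ P.Frozen i x r := fun i hi => by simpa [B] using hi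
  have hcard : A.card ≤ B.card + 2 := card_le_card_add_two hr
    (fun i hi => (Finset.mem_filter.1 hi).2)
    (fun i hi hF => Finset.mem_filter.2 ⟨(Finset.mem_filter.1 hi).1, hF⟩)
  calc _ ≤ P.μ j (P.colorBall j x r B β) :=
        measure_mono (ball_subset_colorBall j hr (fun i hi => (hB i hi).2) β)
    _ ≤ _ := measure_colorBall_le j hB β
    _ ≤ _ := leb_ball_mul_le x hr hr' hcard
    _ ≤ _ := mul_le_mul_right (le_measure_ball j hr (fun i hi hF => by simp [A, hi, hF]) β) _

theorem measure_ballInf_le_mul (p : P.XInf) {r : ℝ} (hr : 0 < r) (hr' : r < √3) :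
    P.μInf (P.ballInf p r) ≤ (4 * 64 ^ 3 : ℝ≥0) * P.μInf (P.ballInf p (r / 2)) := by
  classical
  obtain ⟨β, x, rfl⟩ := P.exists_eq_sheetInf p
  have hfA := P.finite_setOf_frozen x (r := r / 16) (by positivity)
  have hfB := P.finite_setOf_frozen x hr
  set A := hfA.toFinset with hA
  set B := hfB.toFinset with hB
  obtain ⟨l, hl⟩ : ∃ l, ∀ i ∈ B, i < l := ⟨B.sup id + 1, fun i hi =>
    Nat.lt_succ_of_le (Finset.le_sup (f := id) hi)⟩
  have hB' : ∀ i ∈ B, i < l ∧ P.Frozen i x r := fun i hi => ⟨hl i hi, by simpa [hB] using hi⟩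
  have hcard : A.card ≤ B.card + 2 := card_le_card_add_two hr
    (fun i hi => by simpa [hA] using hi) (fun i _ hF => by simpa [hB] using hF)
  -- The colors frozen at radius `r` are visible in `X_l`.
  have hup : P.μInf (P.ballInf (P.sheetInf β x) r) ≤ P.μ l (P.colorBall l x r B β) := by
    have hm : Measurable fun q : P.XInf => q.1 l :=
      (measurable_pi_apply l).comp measurable_subtype_coe
    rw [← P.map_μInf l, Measure.map_apply hm (P.measurableSet_colorBall ..)]
    exact measure_mono fun q hq => ball_subset_colorBall l hr (fun i hi => (hB' i hi).2) β
      ((P.dist_le_distInf l _ q).trans_lt hq)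
  calc _ ≤ _ := hup
    _ ≤ _ := measure_colorBall_le l hB' β
    _ ≤ _ := leb_ball_mul_le x hr hr' hcard
    _ ≤ _ := mul_le_mul_right (le_measure_ballInf hr (fun i hF => by simpa [hA] using hF) β) _

end Params

end NQC

theorem mainTheorem7 :
    ∃ C : ℝ≥0, ∀ P : NQC.Params,
      (∀ (j : ℕ) (p : P.X j) (r : ℝ), 0 < r → r < √3 →
        P.μ j (P.ball j p r) ≤ C * P.μ j (P.ball j p (r / 2))) ∧
      (∀ (p : P.XInf) (r : ℝ), 0 < r → r < √3 →
        P.μInf (P.ballInf p r) ≤ C * P.μInf (P.ballInf p (r / 2))) :=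
  ⟨4 * 64 ^ 3, fun P => ⟨fun j p _ hr hr' => P.measure_ball_le_mul j p hr hr',
    fun p _ hr hr' => P.measure_ballInf_le_mul p hr hr'⟩⟩
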